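/- Let $\mathcal A$ and $\mathcal X$ be finite sets, let $\mathcal H_E$ be a finite-dimensional complex Hilbert space, and let $\rho=\sum_{a\in\mathcal A}P(a)\,|a\rangle\langle a|\otimes\rho_a$ be a classical-quantum state, where $P$ is a probability distribution on $\mathcal A$ and each $\rho_a$ is a density matrix on $\mathcal H_E$. Let $X$ be a random variable with values in $\mathcal X$ and distribution $P^X$, independent of $\rho$, and let $f_x:\mathcal A\to\{1,\dots,M\}$ $(x\in\mathcal X)$ be functions such that the ensemble $f_X$ is universal$_2$, i.e. $\Pr[f_X(a_1)=f_X(a_2)]\le \frac1M$ for all $a_1\ne a_2$ in $\mathcal A$. For a state $\omega$ on a bipartite system $B,F$ with reduced states $\omega^B,\omega^F$, put $I(B:F|\omega)=D(\omega\|\omega^B\otimes\omega^F)$ and $I'(B:F|\omega)=D(\omega\|\omega^B_{\mathrm{mix}}\otimes\omega^F)$, where $\omega^B_{\mathrm{mix}}$ is the completely mixed state and $D(\omega\|\sigma)=\operatorname{Tr}\omega(\log\omega-\log\sigma)$ is the relative entropy, equal to $+\infty$ if the support of $\omega$ is not contained in that of $\sigma$. Let $I'(f_x(A):E|\rho)$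 be the value of $I'$ for the state $\sum_{i=1}^M|i\rangle\langle i|\otimes\sum_{a:f_x(a)=i}P(a)\rho_a$, and let $I(f_X(A):E,X|\rho,P^X)$ and $I'(f_X(A):E,X|\rho,P^X)$ be the values of $I$ and $I'$ for the state $\sum_{x}P^X(x)\sum_{i=1}^M|i\rangle\langle i|\otimes\bigl(\sum_{a:f_x(a)=i}P(a)\rho_a\bigr)\otimes|x\rangle\langle x|$, the second system being $(E,X)$. Put $\rho^E=\sum_aP(a)\rho_a$ and $$H_{1+s}(A|E|\rho)=-\frac1s\log\operatorname{Tr}\rho^{1+s}\bigl(I_A\otimes(\rho^E)^{-s}\bigr),$$ where the negative power is taken on the support of $\rho^E$, and let $v$ be the number of distinct eigenvalues of $\rho^E$. Then for every $s\in(0,1]$, $$I(f_X(A):E,X|\rho,P^X)\le I'(f_X(A):E,X|\rho,P^X)=\mathbb E_X I'(f_X(A):E|\rho)\le\frac{v^sM^s}{s}e^{-sH_{1+s}(A|E|\rho)}=v^s\,\frac{e^{s(\log M-H_{1+s}(A|E|\rho))}}{s}.$$ -/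

import Mathlib

open scoped Kronecker ComplexOrder

noncomputable section

namespace PrivacyAmp

/-- A density matrix: positive semidefinite of trace one. -/
def IsDensity {n : Type*} [Fintype n] (ρ : Matrix n n ℂ) : Prop :=
  ρ.PosSemidef ∧ ρ.trace = 1

/-- Logarithm of a Hermitian matrix through its spectral decomposition, with the usual
convention that the eigenvalue `0` contributes `0`. -/
def matLog {n : Type*} [Fintype n] [DecidableEq n] (ρ : Matrix n n ℂ) : Matrix n n ℂ :=
  cfc Real.log ρ

/-- Real power of a positive semidefinite matrix through its spectral decomposition. For `p ≠ 0`
the eigenvalue `0` contributes `0`, so negative powers are inverses on the support. -/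
def matPow {n : Type*} [Fintype n] [DecidableEq n] (ρ : Matrix n n ℂ) (p : ℝ) : Matrix n n ℂ :=
  cfc (fun x : ℝ => x ^ p) ρ

/-- The support of `ρ` is contained in the support of `σ` (for Hermitian matrices). -/
def SuppLE {n : Type*} [Fintype n] (ρ σ : Matrix n n ℂ) : Prop :=
  ∀ w : n → ℂ, σ.mulVec w = 0 → ρ.mulVec w = 0

open Classical in
/-- Quantum relative entropy `D(ρ‖σ) = Tr ρ (log ρ - log σ)`, which is `+∞` if the support of `ρ`
is not contained in the support of `σ`. The trace is real for Hermitian arguments. -/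
def relEntropy {n : Type*} [Fintype n] [DecidableEq n] (ρ σ : Matrix n n ℂ) : EReal :=
  if SuppLE ρ σ then (((ρ * (matLog ρ - matLog σ)).trace.re : ℝ) : EReal) else ⊤

/-- The reduced state `ρ^E = Tr_A ρ`. -/
def reducedE {A E : Type*} [Fintype A] (ρ : Matrix (A × E) (A × E) ℂ) : Matrix E E ℂ :=
  Matrix.of fun e e' => ∑ a, ρ (a, e) (a, e')

/-- The reduced state `ρ^A = Tr_E ρ`. -/
def reducedA {A E : Type*} [Fintype E] (ρ : Matrix (A × E) (A × E) ℂ) : Matrix A A ℂ :=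
  Matrix.of fun a a' => ∑ e, ρ (a, e) (a', e)

/-- The completely mixed state. -/
def maxMixed (A : Type*) [Fintype A] [DecidableEq A] : Matrix A A ℂ :=
  ((Fintype.card A : ℂ)⁻¹) • (1 : Matrix A A ℂ)

/-- The mutual information `I(A:E|ρ) = D(ρ ‖ ρ^A ⊗ ρ^E)`. -/
def mutualInfo {A E : Type*} [Fintype A] [DecidableEq A] [Fintype E] [DecidableEq E]
    (ρ : Matrix (A × E) (A × E) ℂ) : EReal :=
  relEntropy ρ (reducedA ρ ⊗ₖ reducedE ρ)

/-- The modified mutual information `I'(A:E|ρ) = D(ρ ‖ ρ_mix^A ⊗ ρ^E)`. -/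
def modMutualInfo {A E : Type*} [Fintype A] [DecidableEq A] [Fintype E] [DecidableEq E]
    (ρ : Matrix (A × E) (A × E) ℂ) : EReal :=
  relEntropy ρ (maxMixed A ⊗ₖ reducedE ρ)

/-- The conditional Rényi entropy
`H_{1+s}(A|E|ρ) = -(1/s) log Tr ρ^{1+s} (I_A ⊗ (ρ^E)^{-s})`. -/
def condRenyi {A E : Type*} [Fintype A] [DecidableEq A] [Fintype E] [DecidableEq E]
    (s : ℝ) (ρ : Matrix (A × E) (A × E) ℂ) : ℝ :=
  (-1 / s) *
    Real.log (matPow ρ (1 + s) * ((1 : Matrix A A ℂ) ⊗ₖ matPow (reducedE ρ) (-s))).trace.re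

/-- The classical-quantum state `∑ a, P(a) |a⟩⟨a| ⊗ ρ_a`. -/
def cqState {A E : Type*} [Fintype A] [DecidableEq A]
    (P : A → ℝ) (τ : A → Matrix E E ℂ) : Matrix (A × E) (A × E) ℂ :=
  ∑ a, (P a : ℂ) • (Matrix.single a a (1 : ℂ) ⊗ₖ τ a)

/-- The state of `f(A), E` when the function `f` is applied to the classical register `A`:
the block at the value `b` is the sum of the blocks of `ρ` at the `a` with `f a = b`. -/
def applyFun {A B E : Type*} [Fintype A] [DecidableEq B]
    (f : A → B) (ρ : Matrix (A × E) (A × E) ℂ) : Matrix (B × E) (B × E) ℂ :=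
  Matrix.of fun i j =>
    if i.1 = j.1 then ∑ a with f a = i.1, ρ (a, i.2) (a, j.2) else 0

/-- The state of `f_X(A), (E, X)`, that is `∑ x, Q(x) (state of f_x(A), E) ⊗ |x⟩⟨x|`, when the
public classical random variable `X` with distribution `Q` is drawn independently of `ρ`. -/
def hashedState {A B E X : Type*} [Fintype A] [DecidableEq B] [DecidableEq X]
    (Q : X → ℝ) (f : X → A → B) (ρ : Matrix (A × E) (A × E) ℂ) :
    Matrix (B × (E × X)) (B × (E × X)) ℂ :=
  Matrix.of fun i j =>
    if i.2.2 = j.2.2 then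
      (Q i.2.2 : ℂ) * applyFun (f i.2.2) ρ (i.1, i.2.1) (j.1, j.2.1)
    else 0

/-- The ensemble `f_X : A → {1, …, M}`, with `X` distributed according to `Q`, is universal₂:
distinct inputs collide with probability at most `1 / M`. -/
def IsUniversalTwo {A X : Type*} [Fintype X] {M : ℕ} (Q : X → ℝ) (f : X → A → Fin M) : Prop :=
  ∀ a₁ a₂ : A, a₁ ≠ a₂ → ∑ x with f x a₁ = f x a₂, Q x ≤ 1 / (M : ℝ)

/-- The number of distinct eigenvalues of a Hermitian matrix. -/
def numEigenvalues {n : Type*} [Fintype n] [DecidableEq n] (σ : Matrix n n ℂ) : ℕ :=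
  (spectrum ℝ σ).ncard

end PrivacyAmp

end

open PrivacyAmp

namespace PrivacyAmp

open Matrix
open Polynomial (aeval aeval_algHom_apply coe_aeval_eq_eval)
open scoped Polynomial

/-! ### Supports of positive semidefinite matrices. -/

section Support

variable {n : Type*} [Fintype n]

/-! Write `σ a = P(a) ρ_a` and `R = ρ^E`. All states involved are block diagonal, so each relative
entropy is a finite sum over blocks (`relEntropy_blockHom`) and the value `⊤` never arises. In `I'`
of the hashed state the weights `Q x` cancel between the two logarithms, which leaves the average
over `x`. The difference `I' - I` is the classical relative entropy of the distribution of `f_X(A)`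
from the uniform one, hence nonnegative.

For the bound, regrouping by `a` turns the average into the sum over `a` of `E_X Tr σ_a log(∑_{f a'
= f a} σ_a') - Tr σ_a log(R/M)`. Operator concavity of the logarithm moves the expectation inside;
universality bounds the averaged collision block by `σ_a + R/M` (`collision_posSemidef`); the
pinching inequality bounds `σ_a` by `v` times a matrix commuting with `R`. Operator monotonicity
carries these two bounds through the logarithm.

In a common eigenbasis, with eigenvalues `t_j` of the pinched matrix and `r_j` of `R`, what remains
is `∑ t_j log(1 + v M t_j / r_j)`, at most `(vM)^s / s * ∑ t_j^(1+s) r_j^(-s)`. Since `t_j` is also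
a diagonal entry of `σ_a` itself, Jensen (`conj_diag_rpow_le`) bounds the last sum by `Tr σ_a^(1+s)
R^(-s)`. The estimate for one `a` is `sum_trace_mul_matLog_sub_le`; summing over `a` produces the
Rényi term. -/

theorem conj_diag_nonneg {ρ : Matrix n n ℂ} (hρ : ρ.PosSemidef) (U : Matrix n n ℂ) (j : n) :
    0 ≤ ((star U * ρ * U) j j).re := by
  have := (hρ.conjTranspose_mul_mul_same U).diag_nonneg (i := j)
  exact (Complex.le_def.1 this).1

/-- For positive semidefinite `ρ`, a vector is in the kernel as soon as its quadratic form vanishes,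
and that form is squeezed between `0` and the one of `σ`. -/
theorem SuppLE.of_le {ρ σ : Matrix n n ℂ} (hρ : ρ.PosSemidef) (h : (σ - ρ).PosSemidef) :
    SuppLE ρ σ := by
  intro w hw
  rw [← hρ.dotProduct_mulVec_zero_iff]
  have h1 := h.dotProduct_mulVec_nonneg w
  rw [sub_mulVec, hw, zero_sub, dotProduct_neg, neg_nonneg] at h1
  exact le_antisymm h1 (hρ.dotProduct_mulVec_nonneg w)

theorem SuppLE.smul {ρ σ : Matrix n n ℂ} (h : SuppLE ρ σ) (a : ℝ) {b : ℝ} (hb : b ≠ 0) :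
    SuppLE (a • ρ) (b • σ) := by
  intro w hw
  rw [smul_mulVec] at hw ⊢
  rw [h w ((smul_eq_zero.1 hw).resolve_left hb), smul_zero]

end Support

/-! ### Functional calculus in an eigenbasis. -/

section Cfc

variable {n : Type*} [Fintype n] [DecidableEq n]

/-- Spectra are finite, so every function acts on them as a polynomial; hence `cfc` commutes with
algebra homomorphisms such as `diagConj` and `blockHom`. -/
theorem exists_polynomial_eval_eq {S : Set ℝ} (hS : S.Finite) (f : ℝ → ℝ) :
    ∃ p : ℝ[X], ∀ x ∈ S, p.eval x = f x := by
  refine ⟨Lagrange.interpolate hS.toFinset id f, fun x hx => ?_⟩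
  exact Lagrange.eval_interpolate_at_node (v := id) f (Set.injOn_id _) (by simpa using hx)

theorem finite_spectrum_real (σ : Matrix n n ℂ) : (spectrum ℝ σ).Finite :=
  Matrix.finite_real_spectrum

theorem continuousOn_spectrum (σ : Matrix n n ℂ) (f : ℝ → ℝ) :
    ContinuousOn f (spectrum ℝ σ) :=
  (finite_spectrum_real σ).continuousOn f

theorem cfc_eq_aeval {σ : Matrix n n ℂ} (hσ : σ.IsHermitian) {f : ℝ → ℝ} {p : ℝ[X]}
    (h : ∀ x ∈ spectrum ℝ σ, p.eval x = f x) : cfc f σ = aeval σ p := by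
  rw [← cfc_polynomial p σ hσ]
  exact cfc_congr fun x hx => (h x hx).symm

/-- Conjugation of diagonal matrices by a unitary, as an algebra homomorphism. -/
noncomputable def diagConj (U : unitaryGroup n ℂ) : (n → ℝ) →ₐ[ℝ] Matrix n n ℂ :=
  AlgHom.ofLinearMap
    { toFun := fun d => (U : Matrix n n ℂ) * diagonal (fun j => (d j : ℂ)) * star (U : Matrix n n ℂ)
      map_add' := fun d e => by
        rw [← add_mul, ← mul_add, diagonal_add]; simp
      map_smul' := fun c d => by
        have : diagonal (fun j => ((c • d) j : ℂ)) = c • diagonal (fun j => (d j : ℂ)) := by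
          ext i j; by_cases h : i = j <;> simp [diagonal, h]
        rw [this]; simp }
    (by
      have h : (diagonal fun _ : n => ((1 : ℝ) : ℂ)) = 1 := by simp
      simp only [LinearMap.coe_mk, AddHom.coe_mk, Pi.one_apply, h, mul_one]
      exact Unitary.mul_star_self_of_mem U.2)
    (fun d e => by
      have h : star (U : Matrix n n ℂ) * (U : Matrix n n ℂ) = 1 :=
        Unitary.star_mul_self_of_mem U.2
      simp only [LinearMap.coe_mk, AddHom.coe_mk, Pi.mul_apply]
      calc _ = (U : Matrix n n ℂ) * (diagonal (fun j => (d j : ℂ)) * diagonal (fun j => (e j : ℂ)))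
            * star (U : Matrix n n ℂ) := by rw [diagonal_mul_diagonal]; simp
        _ = (U : Matrix n n ℂ) * diagonal (fun j => (d j : ℂ)) * 1 * diagonal (fun j => (e j : ℂ))
            * star (U : Matrix n n ℂ) := by simp [mul_assoc]
        _ = _ := by rw [← h]; simp only [mul_assoc])

theorem diagConj_apply (U : unitaryGroup n ℂ) (d : n → ℝ) :
    diagConj U d
      = (U : Matrix n n ℂ) * diagonal (fun j => (d j : ℂ)) * star (U : Matrix n n ℂ) := rfl

theorem isHermitian_diagConj (U : unitaryGroup n ℂ) (d : n → ℝ) : (diagConj U d).IsHermitian := by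
  rw [diagConj_apply, star_eq_conjTranspose]
  exact isHermitian_mul_mul_conjTranspose _ (by
    simp [IsHermitian, diagonal_conjTranspose, Pi.star_def])

theorem cfc_diagConj (U : unitaryGroup n ℂ) (d : n → ℝ) (f : ℝ → ℝ) :
    cfc f (diagConj U d) = diagConj U (fun j => f (d j)) := by
  -- Interpolating on the spectrum and on the values of `d` together lets one polynomial serve both
  -- sides.
  obtain ⟨p, hp⟩ := exists_polynomial_eval_eq
    ((finite_spectrum_real (diagConj U d)).union (Set.finite_range d)) f
  rw [cfc_eq_aeval (isHermitian_diagConj U d) (fun x hx => hp x (Or.inl hx)), aeval_algHom_apply]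
  congr 1
  ext j
  rw [← hp (d j) (Or.inr ⟨j, rfl⟩), ← coe_aeval_eq_eval]
  exact (aeval_algHom_apply (Pi.evalAlgHom ℝ (fun _ => ℝ) j) d p).symm

theorem exists_eq_diagConj {σ : Matrix n n ℂ} (hσ : σ.IsHermitian) :
    ∃ (U : unitaryGroup n ℂ) (d : n → ℝ), σ = diagConj U d := by
  refine ⟨hσ.eigenvectorUnitary, hσ.eigenvalues, ?_⟩
  conv_lhs => rw [hσ.spectral_theorem]
  rfl

theorem trace_mul_diagConj (ρ : Matrix n n ℂ) (U : unitaryGroup n ℂ) (d : n → ℝ) :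
    (ρ * diagConj U d).trace.re
      = ∑ j, d j * ((star (U : Matrix n n ℂ) * ρ * (U : Matrix n n ℂ)) j j).re := by
  rw [diagConj_apply, ← mul_assoc, trace_mul_comm, ← mul_assoc, ← mul_assoc]
  simp [trace, mul_diagonal, mul_comm]

theorem diagConj_mulVec_col (U : unitaryGroup n ℂ) (d : n → ℝ) (j : n) :
    diagConj U d *ᵥ (U : Matrix n n ℂ).col j = (d j : ℂ) • (U : Matrix n n ℂ).col j := by
  have h : star (U : Matrix n n ℂ) * (U : Matrix n n ℂ) = 1 := Unitary.star_mul_self_of_mem U.2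
  rw [← mulVec_single_one, mulVec_mulVec, diagConj_apply, mul_assoc, h, mul_one, ← mulVec_mulVec]
  simp

/-- Column `j` of `U` is an eigenvector with eigenvalue `0`, so `ρ` kills it. -/
theorem SuppLE.conj_diag_eq_zero {ρ : Matrix n n ℂ} {U : unitaryGroup n ℂ} {d : n → ℝ}
    (h : SuppLE ρ (diagConj U d)) {j : n} (hj : d j = 0) :
    (star (U : Matrix n n ℂ) * ρ * (U : Matrix n n ℂ)) j j = 0 := by
  have h1 := h ((U : Matrix n n ℂ).col j) (by
    rw [diagConj_mulVec_col, hj]; simp)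
  have h2 : ((star (U : Matrix n n ℂ) * ρ * (U : Matrix n n ℂ)) *ᵥ Pi.single j 1) j = 0 := by
    rw [mul_assoc, ← mulVec_mulVec, ← mulVec_mulVec, mulVec_single_one, h1]; simp
  simpa using h2

/-- In an eigenbasis of `σ` the trace is a sum of values of `f` weighted by diagonal entries of `ρ`.
The weights vanish at the eigenvalue `0`, so the values of `f` and `g` there are irrelevant. -/
theorem trace_mul_cfc_le {ρ σ : Matrix n n ℂ} (hρ : ρ.PosSemidef) (hσ : σ.PosSemidef)
    (h : SuppLE ρ σ) {f g : ℝ → ℝ} (hfg : ∀ x, 0 < x → f x ≤ g x) :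
    (ρ * cfc f σ).trace.re ≤ (ρ * cfc g σ).trace.re := by
  obtain ⟨U, d, hd⟩ := exists_eq_diagConj hσ.1
  have hd0 : ∀ j, 0 ≤ d j := by
    intro j
    have := conj_diag_nonneg hσ U j
    have h1 : star (U : Matrix n n ℂ) * (U : Matrix n n ℂ) = 1 := Unitary.star_mul_self_of_mem U.2
    rw [hd, diagConj_apply, mul_assoc, mul_assoc _ _ (U : Matrix n n ℂ), h1, mul_one, ← mul_assoc,
      h1] at this
    simpa using this
  subst hd
  rw [cfc_diagConj, cfc_diagConj, trace_mul_diagConj, trace_mul_diagConj]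
  refine Finset.sum_le_sum fun j _ => ?_
  rcases (hd0 j).eq_or_lt with h0 | h0
  · rw [h.conj_diag_eq_zero h0.symm]; simp
  · exact mul_le_mul_of_nonneg_right (hfg _ h0) (conj_diag_nonneg hρ _ _)

theorem trace_mul_cfc_congr {ρ σ : Matrix n n ℂ} (hρ : ρ.PosSemidef) (hσ : σ.PosSemidef)
    (h : SuppLE ρ σ) {f g : ℝ → ℝ} (hfg : ∀ x, 0 < x → f x = g x) :
    (ρ * cfc f σ).trace.re = (ρ * cfc g σ).trace.re :=
  le_antisymm (trace_mul_cfc_le hρ hσ h fun x hx => (hfg x hx).le)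
    (trace_mul_cfc_le hρ hσ h fun x hx => (hfg x hx).ge)

/-- With the convention `log 0 = 0`, the rule `log (c σ) = log σ + log c` can fail on the kernel of
`σ`, but `ρ` does not see that kernel. -/
theorem trace_mul_matLog_smul {ρ σ : Matrix n n ℂ} (hρ : ρ.PosSemidef) (hσ : σ.PosSemidef)
    (h : SuppLE ρ σ) {c : ℝ} (hc : 0 < c) :
    (ρ * matLog (c • σ)).trace.re = (ρ * matLog σ).trace.re + Real.log c * ρ.trace.re := by
  have h1 : matLog (c • σ) = cfc (fun x => Real.log (c * x)) σ :=
    (cfc_comp_const_mul c Real.log σ (((finite_spectrum_real σ).image _).continuousOn _)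
      hσ.1).symm
  have h2 : cfc (fun x => Real.log x + Real.log c) σ = matLog σ + algebraMap ℝ _ (Real.log c) :=
    cfc_add_const (Real.log c) Real.log σ (continuousOn_spectrum _ _) hσ.1
  rw [h1, trace_mul_cfc_congr hρ hσ h (g := fun x => Real.log x + Real.log c), h2, mul_add,
    trace_add, Complex.add_re, Algebra.algebraMap_eq_smul_one]
  · simp
  · intro x hx
    rw [Real.log_mul hc.ne' hx.ne', add_comm]

end Cfc

/-! ### Block diagonal matrices. -/

section Block

variable {n K E : Type*} [Fintype n] [DecidableEq n] [Fintype K] [DecidableEq K] [Fintype E]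
  [DecidableEq E]

/-- The block diagonal matrix with the given blocks, along an identification of the index set
with a product, as an algebra homomorphism. -/
noncomputable def blockHom (e : n ≃ K × E) : (K → Matrix E E ℂ) →ₐ[ℝ] Matrix n n ℂ :=
  AlgHom.ofLinearMap
    { toFun := fun α => Matrix.of fun i j =>
        if (e i).1 = (e j).1 then α (e i).1 (e i).2 (e j).2 else 0
      map_add' := fun α β => by
        ext i j; by_cases h : (e i).1 = (e j).1 <;> simp [h]
      map_smul' := fun c α => by
        ext i j; by_cases h : (e i).1 = (e j).1 <;> simp [h] }
    (by
      ext i j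
      by_cases h : (e i).1 = (e j).1
      · have : i = j ↔ (e i).2 = (e j).2 := by
          rw [← e.injective.eq_iff, Prod.ext_iff]; simp [h]
        simp [h, one_apply, this]
      · have : i ≠ j := by rintro rfl; exact h rfl
        simp [h, one_apply, this])
    (fun α β => by
      ext i j
      simp only [LinearMap.coe_mk, AddHom.coe_mk, of_apply, mul_apply]
      rw [← e.symm.sum_comp, Fintype.sum_prod_type]
      simp only [Equiv.apply_symm_apply]
      by_cases h : (e i).1 = (e j).1
      · simp [h, mul_apply]
      · simp [h])

theorem blockHom_apply (e : n ≃ K × E) (α : K → Matrix E E ℂ) (i j : n) :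
    blockHom e α i j = if (e i).1 = (e j).1 then α (e i).1 (e i).2 (e j).2 else 0 := rfl

theorem isHermitian_blockHom (e : n ≃ K × E) {α : K → Matrix E E ℂ}
    (h : ∀ k, (α k).IsHermitian) : (blockHom e α).IsHermitian := by
  ext i j
  rw [conjTranspose_apply, blockHom_apply, blockHom_apply]
  by_cases hij : (e i).1 = (e j).1
  · simp only [hij, if_true]
    exact (h _).apply _ _
  · simp [hij, Ne.symm hij]

theorem cfc_blockHom (e : n ≃ K × E) {α : K → Matrix E E ℂ}
    (h : ∀ k, (α k).IsHermitian) (f : ℝ → ℝ) :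
    cfc f (blockHom e α) = blockHom e (fun k => cfc f (α k)) := by
  obtain ⟨p, hp⟩ := exists_polynomial_eval_eq
    ((finite_spectrum_real (blockHom e α)).union
      (Set.finite_iUnion fun k => finite_spectrum_real (α k))) f
  rw [cfc_eq_aeval (isHermitian_blockHom e h) (fun x hx => hp x (Or.inl hx)), aeval_algHom_apply]
  congr 1
  ext1 k
  rw [cfc_eq_aeval (h k) (fun x hx => hp x (Or.inr (Set.mem_iUnion.2 ⟨k, hx⟩)))]
  exact (aeval_algHom_apply (Pi.evalAlgHom ℝ (fun _ => Matrix E E ℂ) k) α p).symm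

theorem trace_blockHom (e : n ≃ K × E) (α : K → Matrix E E ℂ) :
    (blockHom e α).trace = ∑ k, (α k).trace := by
  simp only [trace, diag_apply, blockHom_apply, if_true]
  rw [← e.symm.sum_comp, Fintype.sum_prod_type]
  simp

theorem blockHom_mulVec (e : n ≃ K × E) (α : K → Matrix E E ℂ) (w : n → ℂ) (i : n) :
    (blockHom e α *ᵥ w) i = (α (e i).1 *ᵥ fun x => w (e.symm ((e i).1, x))) (e i).2 := by
  simp only [mulVec, dotProduct, blockHom_apply]
  rw [← e.symm.sum_comp, Fintype.sum_prod_type]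
  simp only [Equiv.apply_symm_apply, ite_mul, zero_mul]
  rw [Finset.sum_eq_single (e i).1]
  · simp
  · intro b _ hb; simp [hb.symm]
  · simp

theorem suppLE_blockHom (e : n ≃ K × E) {α β : K → Matrix E E ℂ}
    (h : ∀ k, SuppLE (α k) (β k)) : SuppLE (blockHom e α) (blockHom e β) := by
  intro w hw
  ext i
  rw [blockHom_mulVec, h]
  · rfl
  · ext x
    have := congrFun hw (e.symm ((e i).1, x))
    rw [blockHom_mulVec] at this
    simpa using this

theorem relEntropy_blockHom (e : n ≃ K × E) {α β : K → Matrix E E ℂ}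
    (hα : ∀ k, (α k).IsHermitian) (hβ : ∀ k, (β k).IsHermitian) (h : ∀ k, SuppLE (α k) (β k)) :
    relEntropy (blockHom e α) (blockHom e β)
      = ((∑ k, ((α k * matLog (α k)).trace.re - (α k * matLog (β k)).trace.re) : ℝ) : EReal) := by
  rw [relEntropy, if_pos (suppLE_blockHom e h), matLog, matLog, cfc_blockHom e hα,
    cfc_blockHom e hβ, ← map_sub, ← map_mul, trace_blockHom, Complex.re_sum]
  simp [mul_sub, trace_sub, matLog]

end Block

/-! ### Operator monotonicity and concavity of the logarithm. -/

section OperatorLog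

open scoped MatrixOrder Matrix.Norms.L2Operator

variable {n X : Type*} [Fintype n] [DecidableEq n] [Fintype X]

theorem matLog_sub_matLog_posSemidef {σ τ : Matrix n n ℂ} (hσ : σ.PosDef)
    (h : (τ - σ).PosSemidef) : (matLog τ - matLog σ).PosSemidef :=
  le_iff.1 (CFC.log_le_log (le_iff.2 h) (isStrictlyPositive_iff_posDef.2 hσ))

theorem matLog_sum_sub_sum_matLog_posSemidef {Q : X → ℝ} (hQ : Q ∈ stdSimplex ℝ X)
    {σ : X → Matrix n n ℂ} (hσ : ∀ x, (σ x).PosDef) :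
    (matLog (∑ x, Q x • σ x) - ∑ x, Q x • matLog (σ x)).PosSemidef :=
  le_iff.1 (CFC.concaveOn_log.le_map_sum (fun x _ => hQ.1 x) hQ.2
    (fun x _ => isStrictlyPositive_iff_posDef.2 (hσ x)))

theorem trace_mul_re_nonneg {σ τ : Matrix n n ℂ} (hσ : σ.PosSemidef) (hτ : τ.PosSemidef) :
    0 ≤ (σ * τ).trace.re := by
  obtain ⟨C, rfl⟩ := CStarAlgebra.nonneg_iff_eq_star_mul_self.mp hσ.nonneg
  rw [mul_assoc, trace_mul_comm]
  have := (hτ.mul_mul_conjTranspose_same C).trace_nonneg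
  exact (Complex.le_def.1 this).1

end OperatorLog

/-! ### Simultaneous diagonalization. -/

section JointBasis

variable {F ι : Type*} [NormedAddCommGroup F] [InnerProductSpace ℂ F] [FiniteDimensional ℂ F]
  [Fintype ι]

theorem exists_joint_orthonormalBasis {S T : F →ₗ[ℂ] F} (hS : S.IsSymmetric) (hT : T.IsSymmetric)
    (hc : Commute S T) (hF : Module.finrank ℂ F = Fintype.card ι) :
    ∃ b : OrthonormalBasis ι ℂ F, ∀ j, ∃ i : ℂ × ℂ, S (b j) = i.2 • b j ∧ T (b j) = i.1 • b j := by
  classical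
  have hint := LinearMap.IsSymmetric.directSum_isInternal_of_commute hS hT hc
  have hort := LinearMap.IsSymmetric.orthogonalFamily_eigenspace_inf_eigenspace hS hT
  generalize hV : (fun i : ℂ × ℂ => Module.End.eigenspace S i.2 ⊓ Module.End.eigenspace T i.1) = V
    at hint
  have hort : OrthogonalFamily ℂ (fun i => V i) fun i => (V i).subtypeₗᵢ := by
    subst hV; exact hort
  have hmem : ∀ i x, x ∈ V i → S x = i.2 • x ∧ T x = i.1 • x := by
    subst hV
    exact fun i x hx => ⟨Module.End.mem_eigenspace_iff.1 hx.1, Module.End.mem_eigenspace_iff.1 hx.2⟩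
  -- The joint eigenspaces are indexed by all of `ℂ × ℂ`; an adapted orthonormal basis requires the
  -- finite subfamily of nonzero ones.
  have hfin : {i | V i ≠ ⊥}.Finite :=
    WellFoundedGT.finite_ne_bot_of_iSupIndep hint.submodule_iSupIndep
  let _ : Fintype {i // V i ≠ ⊥} := hfin.fintype
  have hint' := DirectSum.isInternal_ne_bot_iff.2 hint
  have hort' := hort.comp (Subtype.val_injective (p := fun i => V i ≠ ⊥))
  refine ⟨(hint'.subordinateOrthonormalBasis hF hort').reindex (Fintype.equivFin ι).symm,
    fun j => ?_⟩
  rw [OrthonormalBasis.reindex_apply]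
  exact ⟨_, hmem _ _ (hint'.subordinateOrthonormalBasis_subordinate hF _ hort')⟩

end JointBasis

/-! ### Common eigenbases of matrices and Jensen for diagonal entries. -/

section Joint

variable {n : Type*} [Fintype n] [DecidableEq n]

/-- The unitary matrix whose columns are the vectors of an orthonormal basis. -/
noncomputable def basisUnitary (b : OrthonormalBasis n ℂ (EuclideanSpace ℂ n)) :
    unitaryGroup n ℂ :=
  ⟨(EuclideanSpace.basisFun n ℂ).toBasis.toMatrix b,
    (EuclideanSpace.basisFun n ℂ).toMatrix_orthonormalBasis_mem_unitary b⟩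

theorem basisUnitary_apply (b : OrthonormalBasis n ℂ (EuclideanSpace ℂ n)) (i j : n) :
    (basisUnitary b : Matrix n n ℂ) i j = b j i := by
  simp [basisUnitary, Module.Basis.toMatrix_apply]

theorem eq_diagConj_of_eigenvectors {S : Matrix n n ℂ} (hS : S.IsHermitian)
    (b : OrthonormalBasis n ℂ (EuclideanSpace ℂ n)) {c : n → ℂ}
    (hc : ∀ j, toEuclideanLin S (b j) = c j • b j) :
    S = diagConj (basisUnitary b) (fun j => (c j).re) := by
  have hU : star (basisUnitary b : Matrix n n ℂ) * (basisUnitary b : Matrix n n ℂ) = 1 :=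
    Unitary.star_mul_self_of_mem (basisUnitary b).2
  have hU' : (basisUnitary b : Matrix n n ℂ) * star (basisUnitary b : Matrix n n ℂ) = 1 :=
    Unitary.mul_star_self_of_mem (basisUnitary b).2
  have h1 : S * (basisUnitary b : Matrix n n ℂ)
      = (basisUnitary b : Matrix n n ℂ) * diagonal c := by
    ext k j
    have := congrArg (fun w : EuclideanSpace ℂ n => w k) (hc j)
    rw [mul_diagonal, mul_apply, basisUnitary_apply, mul_comm]
    simp only [basisUnitary_apply]
    exact this
  have h2 : star (basisUnitary b : Matrix n n ℂ) * S * (basisUnitary b : Matrix n n ℂ)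
      = diagonal c := by
    rw [mul_assoc, h1, ← mul_assoc, hU, one_mul]
  have h3 : (diagonal c).IsHermitian := by
    rw [← h2]; exact isHermitian_conjTranspose_mul_mul _ hS
  have h4 : (fun j => (((c j).re : ℝ) : ℂ)) = c := by
    ext1 j
    have := h3.apply j j
    simp only [diagonal_apply_eq] at this
    exact Complex.conj_eq_iff_re.1 this
  rw [diagConj_apply, h4, ← h1, mul_assoc, hU', mul_one]

theorem exists_common_diagConj {T R : Matrix n n ℂ} (hT : T.IsHermitian) (hR : R.IsHermitian)
    (h : Commute T R) :
    ∃ (U : unitaryGroup n ℂ) (t r : n → ℝ), T = diagConj U t ∧ R = diagConj U r := by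
  have hc : Commute (toEuclideanLin T) (toEuclideanLin R) := by
    change toEuclideanLin T ∘ₗ toEuclideanLin R = toEuclideanLin R ∘ₗ toEuclideanLin T
    rw [← toLpLin_mul_same, ← toLpLin_mul_same, h.eq]
  obtain ⟨b, hb⟩ := exists_joint_orthonormalBasis (ι := n) (isSymmetric_toEuclideanLin_iff.2 hT)
    (isSymmetric_toEuclideanLin_iff.2 hR) hc finrank_euclideanSpace
  choose i hi using hb
  exact ⟨basisUnitary b, _, _, eq_diagConj_of_eigenvectors hT b fun j => (hi j).1,
    eq_diagConj_of_eigenvectors hR b fun j => (hi j).2⟩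

theorem diagConj_conj (U : unitaryGroup n ℂ) (d : n → ℝ) :
    star (U : Matrix n n ℂ) * diagConj U d * (U : Matrix n n ℂ)
      = diagonal (fun j => (d j : ℂ)) := by
  have h : star (U : Matrix n n ℂ) * (U : Matrix n n ℂ) = 1 := Unitary.star_mul_self_of_mem U.2
  rw [diagConj_apply, mul_assoc, mul_assoc _ _ (U : Matrix n n ℂ), h, mul_one, ← mul_assoc, h,
    one_mul]

theorem diagConj_injective (U : unitaryGroup n ℂ) : Function.Injective (diagConj U) := by
  intro d e h
  have := diagConj_conj U d
  rw [h, diagConj_conj] at this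
  ext j
  simpa using (congrFun (congrFun this j) j).symm

/-- Otherwise `d j - diagConj U d` would be invertible, although it annihilates the nonzero
projection onto the `j`-th basis vector. -/
theorem mem_spectrum_diagConj (U : unitaryGroup n ℂ) (d : n → ℝ) (j : n) :
    d j ∈ spectrum ℝ (diagConj U d) := by
  rw [spectrum.mem_iff, ← AlgHom.commutes (diagConj U), ← map_sub]
  intro h
  have h0 : (algebraMap ℝ (n → ℝ) (d j) - d) * Pi.single j 1 = 0 := by
    ext k
    by_cases hk : k = j
    · subst hk; simp
    · simp [hk]
  have h1 : diagConj U (algebraMap ℝ (n → ℝ) (d j) - d) * diagConj U (Pi.single j 1) = 0 := by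
    rw [← map_mul, h0, map_zero]
  have h2 : diagConj U (Pi.single j 1) = diagConj U 0 := by
    rw [h.mul_right_eq_zero.1 h1, map_zero]
  simpa using congrFun (diagConj_injective U h2) j

/-- A diagonal entry of `σ` in any orthonormal basis is a convex combination of the eigenvalues,
with weights the squared moduli of the overlaps with eigenvectors; then Jensen for `x ^ p`. -/
theorem conj_diag_rpow_le {σ : Matrix n n ℂ} (hσ : σ.PosSemidef) (U : unitaryGroup n ℂ) (j : n)
    {p : ℝ} (hp : 1 ≤ p) :
    ((star (U : Matrix n n ℂ) * σ * (U : Matrix n n ℂ)) j j).re ^ p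
      ≤ ((star (U : Matrix n n ℂ) * matPow σ p * (U : Matrix n n ℂ)) j j).re := by
  obtain ⟨V, d, hd⟩ := exists_eq_diagConj hσ.1
  have hd0 : ∀ k, 0 ≤ d k := by
    intro k
    have := conj_diag_nonneg hσ V k
    rw [hd, diagConj_conj] at this
    simpa using this
  have formula : ∀ e : n → ℝ, ((star (U : Matrix n n ℂ) * diagConj V e * (U : Matrix n n ℂ)) j j).re
      = ∑ k, Complex.normSq ((star (U : Matrix n n ℂ) * (V : Matrix n n ℂ)) j k) * e k := by
    intro e
    have : star (U : Matrix n n ℂ) * diagConj V e * (U : Matrix n n ℂ)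
        = (star (U : Matrix n n ℂ) * (V : Matrix n n ℂ)) * diagonal (fun k => (e k : ℂ))
          * star (star (U : Matrix n n ℂ) * (V : Matrix n n ℂ)) := by
      rw [diagConj_apply, star_mul, star_star]; simp only [mul_assoc]
    rw [this, mul_apply, Complex.re_sum]
    refine Finset.sum_congr rfl fun k _ => ?_
    rw [mul_diagonal, star_apply, mul_right_comm, RCLike.star_def, Complex.mul_conj]
    norm_cast
  -- The weights sum to one: this is `formula` at the identity matrix.
  have hone : ∑ k, Complex.normSq ((star (U : Matrix n n ℂ) * (V : Matrix n n ℂ)) j k) = 1 := by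
    have := formula 1
    rw [map_one, mul_one, Unitary.star_mul_self_of_mem U.2] at this
    simpa using this.symm
  rw [hd, matPow, cfc_diagConj, formula, formula]
  simpa using (convexOn_rpow hp).map_sum_le (t := Finset.univ) (p := d)
    (fun k _ => Complex.normSq_nonneg _) hone (fun k _ => hd0 k)

end Joint

/-! ### Pinching by spectral projections. -/

section Pinching

variable {n : Type*} [Fintype n] [DecidableEq n]

/-- The spectral projection of `R` at the eigenvalue `k`. -/
noncomputable def spectralProj (R : Matrix n n ℂ) (k : ℝ) : Matrix n n ℂ :=
  cfc (fun x => if x = k then 1 else 0) R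

/-- The pinching of `σ` by the spectral projections of `R`. -/
noncomputable def pinching (R σ : Matrix n n ℂ) : Matrix n n ℂ :=
  ∑ k ∈ (finite_spectrum_real R).toFinset, spectralProj R k * σ * spectralProj R k

theorem spectralProj_diagConj (U : unitaryGroup n ℂ) (r : n → ℝ) (k : ℝ) :
    spectralProj (diagConj U r) k = diagConj U (fun j => if r j = k then 1 else 0) :=
  cfc_diagConj _ _ _

theorem isHermitian_spectralProj (R : Matrix n n ℂ) (k : ℝ) : (spectralProj R k).IsHermitian :=
  cfc_predicate (R := ℝ) (p := IsSelfAdjoint) _ R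

theorem sum_spectralProj {R : Matrix n n ℂ} (hR : R.IsHermitian) :
    ∑ k ∈ (finite_spectrum_real R).toFinset, spectralProj R k = 1 := by
  obtain ⟨U, r, hr⟩ := exists_eq_diagConj hR
  have hmem : ∀ j, r j ∈ spectrum ℝ R := fun j => hr ▸ mem_spectrum_diagConj U r j
  calc _ = ∑ k ∈ (finite_spectrum_real R).toFinset,
        diagConj U (fun j => if r j = k then 1 else 0) :=
        Finset.sum_congr rfl fun k _ => by rw [← spectralProj_diagConj, ← hr]
    _ = 1 := by
      rw [← map_sum, ← map_one (diagConj U)]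
      congr 1
      ext j
      simp [hmem j]

theorem pinching_posSemidef (R : Matrix n n ℂ) {σ : Matrix n n ℂ} (hσ : σ.PosSemidef) :
    (pinching R σ).PosSemidef := by
  refine posSemidef_sum _ fun k _ => ?_
  have := hσ.conjTranspose_mul_mul_same (spectralProj R k)
  rwa [(isHermitian_spectralProj R k).eq] at this

theorem commute_pinching {R : Matrix n n ℂ} (hR : R.IsHermitian) (σ : Matrix n n ℂ) :
    Commute (pinching R σ) R := by
  obtain ⟨U, r, hr⟩ := exists_eq_diagConj hR
  refine Commute.sum_left _ _ _ fun k _ => ?_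
  have h1 : spectralProj R k * R = k • spectralProj R k := by
    rw [hr, spectralProj_diagConj, ← map_mul, ← map_smul]
    congr 1; ext j; by_cases h : r j = k <;> simp [h]
  have h2 : R * spectralProj R k = k • spectralProj R k := by
    rw [hr, spectralProj_diagConj, ← map_mul, ← map_smul]
    congr 1; ext j; by_cases h : r j = k <;> simp [h]
  rw [Commute, SemiconjBy, mul_assoc, h1, ← mul_assoc, ← mul_assoc, h2]
  simp

/-- In an eigenbasis of `R`, pinching only erases entries between different eigenvalues, so the
diagonal survives. -/
theorem conj_pinching_diag (U : unitaryGroup n ℂ) (r : n → ℝ) (σ : Matrix n n ℂ) (j : n) :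
    (star (U : Matrix n n ℂ) * pinching (diagConj U r) σ * (U : Matrix n n ℂ)) j j
      = (star (U : Matrix n n ℂ) * σ * (U : Matrix n n ℂ)) j j := by
  have hU : star (U : Matrix n n ℂ) * (U : Matrix n n ℂ) = 1 := Unitary.star_mul_self_of_mem U.2
  have h : ∀ k, star (U : Matrix n n ℂ) * (spectralProj (diagConj U r) k * σ *
      spectralProj (diagConj U r) k) * (U : Matrix n n ℂ)
      = diagonal (fun j => ((if r j = k then 1 else 0 : ℝ) : ℂ))
        * (star (U : Matrix n n ℂ) * σ * (U : Matrix n n ℂ))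
        * diagonal (fun j => ((if r j = k then 1 else 0 : ℝ) : ℂ)) := by
    intro k
    rw [spectralProj_diagConj, diagConj_apply]
    calc _ = (star (U : Matrix n n ℂ) * (U : Matrix n n ℂ))
          * diagonal (fun j => ((if r j = k then 1 else 0 : ℝ) : ℂ))
        * (star (U : Matrix n n ℂ) * σ * (U : Matrix n n ℂ))
        * diagonal (fun j => ((if r j = k then 1 else 0 : ℝ) : ℂ))
        * (star (U : Matrix n n ℂ) * (U : Matrix n n ℂ)) := by simp only [mul_assoc]
      _ = _ := by rw [hU, one_mul, mul_one]
  rw [pinching, Finset.mul_sum, Finset.sum_mul, Matrix.sum_apply]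
  simp only [h, mul_diagonal, diagonal_mul]
  rw [Finset.sum_eq_single (r j)]
  · simp
  · intro k _ hk; simp [hk.symm]
  · intro hk
    exact absurd ((Set.Finite.mem_toFinset _).2 (mem_spectrum_diagConj U r j)) hk

theorem numEigenvalues_eq_card (R : Matrix n n ℂ) :
    numEigenvalues R = (finite_spectrum_real R).toFinset.card :=
  Set.ncard_eq_toFinset_card _ _

/-- The pinching inequality. -/
theorem smul_pinching_sub_posSemidef {R σ : Matrix n n ℂ} (hR : R.IsHermitian)
    (hσ : σ.PosSemidef) : (((numEigenvalues R : ℝ)) • pinching R σ - σ).PosSemidef := by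
  set S := (finite_spectrum_real R).toFinset with hS
  -- For projections `P_k` summing to one, the double sum of `(P_k - P_l) σ (P_k - P_l)` has square
  -- terms adding up to `2 v` times the pinching and cross terms adding up to `-2 σ`.
  have h1 : (∑ k ∈ S, ∑ l ∈ S, (spectralProj R k - spectralProj R l) * σ *
      (spectralProj R k - spectralProj R l)).PosSemidef := by
    refine posSemidef_sum _ fun k _ => posSemidef_sum _ fun l _ => ?_
    have := hσ.conjTranspose_mul_mul_same (spectralProj R k - spectralProj R l)
    rwa [((isHermitian_spectralProj R k).sub (isHermitian_spectralProj R l)).eq] at this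
  have h2 : ∑ k ∈ S, ∑ l ∈ S, spectralProj R k * σ * spectralProj R l = σ := by
    simp_rw [← Finset.mul_sum, ← Finset.sum_mul]
    rw [sum_spectralProj hR, one_mul, mul_one]
  have h3 : ∑ k ∈ S, ∑ l ∈ S, (spectralProj R k - spectralProj R l) * σ *
      (spectralProj R k - spectralProj R l)
      = (2 : ℝ) • ((numEigenvalues R : ℝ) • pinching R σ - σ) := by
    have h4 : ∀ k l, (spectralProj R k - spectralProj R l) * σ *
      (spectralProj R k - spectralProj R l) = spectralProj R k * σ * spectralProj R k
        - spectralProj R k * σ * spectralProj R l - spectralProj R l * σ * spectralProj R k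
        + spectralProj R l * σ * spectralProj R l := fun k l => by noncomm_ring
    simp only [h4, Finset.sum_add_distrib, Finset.sum_sub_distrib]
    rw [Finset.sum_comm (f := fun k l => spectralProj R l * σ * spectralProj R k), h2,
      numEigenvalues_eq_card, pinching, ← hS]
    simp only [Finset.sum_const, ← Finset.smul_sum]
    rw [← Nat.cast_smul_eq_nsmul ℝ, smul_sub, two_smul, two_smul]
    abel
  have h5 := h1.smul (show (0 : ℝ) ≤ 1 / 2 by norm_num)
  rw [h3, smul_smul] at h5
  simpa using h5

end Pinching

/-! ### Scalar inequalities. -/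

/-- Subadditivity of `x ^ s` for `s ≤ 1` gives `s log (1 + x) ≤ log (1 + x ^ s) ≤ x ^ s`. -/
theorem log_one_add_le_rpow_div {x s : ℝ} (hx : 0 ≤ x) (hs0 : 0 < s) (hs1 : s ≤ 1) :
    Real.log (1 + x) ≤ x ^ s / s := by
  have h1 : (1 + x) ^ s ≤ 1 + x ^ s := by
    simpa using Real.rpow_add_le_add_rpow zero_le_one hx hs0.le hs1
  have h2 : s * Real.log (1 + x) ≤ x ^ s := by
    rw [← Real.log_rpow (by linarith)]
    have h3 := Real.log_le_sub_one_of_pos (show 0 < 1 + x ^ s by positivity)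
    have h4 := Real.log_le_log (by positivity) h1
    linarith
  rw [le_div_iff₀ hs0]; linarith

theorem mul_log_sub_log_le {t r c v s : ℝ} (ht : 0 ≤ t) (hr : 0 < r) (hc : 0 < c) (hv : 0 ≤ v)
    (hs0 : 0 < s) (hs1 : s ≤ 1) :
    t * Real.log (v * t + c * r) - t * Real.log (c * r)
      ≤ (v / c) ^ s / s * (t ^ (1 + s) * r ^ (-s)) := by
  have hcr : 0 < c * r := mul_pos hc hr
  have h1 : Real.log (v * t + c * r) - Real.log (c * r) = Real.log (1 + v / c * t / r) := by
    rw [← Real.log_div (by positivity) hcr.ne']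
    congr 1; field_simp; ring
  have h2 := log_one_add_le_rpow_div (x := v / c * t / r) (by positivity) hs0 hs1
  rw [← mul_sub, h1]
  refine (mul_le_mul_of_nonneg_left h2 ht).trans_eq ?_
  rw [Real.div_rpow (by positivity) hr.le, Real.mul_rpow (by positivity) ht, Real.rpow_neg hr.le,
    Real.rpow_one_add' ht (by linarith)]
  field_simp

theorem posDef_add_smul_one {n : Type*} [DecidableEq n] {σ : Matrix n n ℂ} (hσ : σ.PosSemidef) {ε : ℝ} (hε : 0 < ε) :
    (σ + ε • (1 : Matrix n n ℂ)).PosDef :=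
  PosDef.posSemidef_add hσ (PosDef.one.smul hε)

/-! ### The estimate for one value of `a`. -/

section

variable {n X : Type*} [Fintype n] [DecidableEq n] [Fintype X]

/-- The shift by `ε` makes matrices positive definite, where the operator inequalities for the
logarithm apply. -/
theorem trace_mul_matLog_le_add {ρ σ : Matrix n n ℂ} (hρ : ρ.PosSemidef) (hσ : σ.PosSemidef)
    (h : SuppLE ρ σ) {ε : ℝ} (hε : 0 < ε) :
    (ρ * matLog σ).trace.re ≤ (ρ * matLog (σ + ε • (1 : Matrix n n ℂ))).trace.re := by
  have h1 : matLog (σ + ε • (1 : Matrix n n ℂ)) = cfc (fun x => Real.log (x + ε)) σ := by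
    obtain ⟨U, d, rfl⟩ := exists_eq_diagConj hσ.1
    rw [← map_one (diagConj U), ← map_smul, ← map_add, matLog, cfc_diagConj, cfc_diagConj]
    congr 1; ext j; simp
  rw [h1]
  exact trace_mul_cfc_le hρ hσ h fun x hx => Real.log_le_log hx (by linarith)

theorem sum_trace_mul_matLog_le {ρ γ : Matrix n n ℂ} (hρ : ρ.PosSemidef) {Q : X → ℝ}
    (hQ : Q ∈ stdSimplex ℝ X) {β : X → Matrix n n ℂ} (hβ : ∀ x, (β x).PosSemidef)
    (h : ∀ x, SuppLE ρ (β x)) (hγ : (γ - ∑ x, Q x • β x).PosSemidef) {ε : ℝ} (hε : 0 < ε) :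
    ∑ x, Q x * (ρ * matLog (β x)).trace.re
      ≤ (ρ * matLog (γ + ε • (1 : Matrix n n ℂ))).trace.re := by
  have hpd : ∀ x, (β x + ε • (1 : Matrix n n ℂ)).PosDef := fun x => posDef_add_smul_one (hβ x) hε
  have hsum : ∑ x, Q x • (β x + ε • (1 : Matrix n n ℂ))
      = ∑ x, Q x • β x + ε • (1 : Matrix n n ℂ) := by
    simp_rw [smul_add, Finset.sum_add_distrib, ← Finset.sum_smul, hQ.2, one_smul]
  have h1 : ∑ x, Q x * (ρ * matLog (β x)).trace.re
      ≤ (ρ * ∑ x, Q x • matLog (β x + ε • (1 : Matrix n n ℂ))).trace.re := by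
    rw [Finset.mul_sum, trace_sum, Complex.re_sum]
    refine Finset.sum_le_sum fun x _ => ?_
    rw [mul_smul_comm, trace_smul, Complex.smul_re, smul_eq_mul]
    exact mul_le_mul_of_nonneg_left (trace_mul_matLog_le_add hρ (hβ x) (h x) hε) (hQ.1 x)
  have h2 := trace_mul_re_nonneg hρ (matLog_sum_sub_sum_matLog_posSemidef hQ hpd)
  have h3 : (∑ x, Q x • β x + ε • (1 : Matrix n n ℂ)).PosDef :=
    posDef_add_smul_one (posSemidef_sum _ fun x _ => (hβ x).smul (hQ.1 x)) hε
  have h4 := trace_mul_re_nonneg hρ (matLog_sub_matLog_posSemidef h3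
    (τ := γ + ε • (1 : Matrix n n ℂ)) (by simpa using hγ))
  rw [hsum, mul_sub, trace_sub, Complex.sub_re] at h2
  rw [mul_sub, trace_sub, Complex.sub_re] at h4
  linarith

/-- Applied with `c = 1/M`, with `β x` the block of the hashed state containing `a`, and with `hsum`
supplied by universality. -/
theorem sum_trace_mul_matLog_sub_le {σ R : Matrix n n ℂ} (hσ : σ.PosSemidef) (hR : R.PosSemidef)
    (hσR : SuppLE σ R) {Q : X → ℝ} (hQ : Q ∈ stdSimplex ℝ X) {β : X → Matrix n n ℂ}
    (hβ : ∀ x, (β x).PosSemidef) (h : ∀ x, SuppLE σ (β x)) {c : ℝ} (hc : 0 < c)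
    (hsum : (σ + c • R - ∑ x, Q x • β x).PosSemidef) {s : ℝ} (hs0 : 0 < s) (hs1 : s ≤ 1) :
    ∑ x, Q x * (σ * matLog (β x)).trace.re - (σ * matLog (c • R)).trace.re
      ≤ ((numEigenvalues R : ℝ) / c) ^ s / s * (matPow σ (1 + s) * matPow R (-s)).trace.re := by
  set v : ℝ := (numEigenvalues R : ℝ) with hv
  obtain ⟨U, t, r, hT, hr⟩ := exists_common_diagConj (pinching_posSemidef R hσ).1 hR.1
    (commute_pinching hR.1 σ)
  -- The eigenvalues of the pinched matrix are diagonal entries of `σ` itself; this later allows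
  -- Jensen for the unpinched `σ`.
  have ht : ∀ j, ((star (U : Matrix n n ℂ) * σ * (U : Matrix n n ℂ)) j j).re = t j := by
    intro j
    have h1 := conj_pinching_diag U r σ j
    rw [← hr, hT, diagConj_conj] at h1
    rw [← h1]; simp
  have ht0 : ∀ j, 0 ≤ t j := fun j => ht j ▸ conj_diag_nonneg hσ _ j
  have hr0 : ∀ j, 0 ≤ r j := by
    intro j
    have := conj_diag_nonneg hR U j
    rw [hr, diagConj_conj] at this
    simpa using this
  have htr : ∀ j, r j = 0 → t j = 0 := by
    intro j hj
    rw [hr] at hσR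
    rw [← ht, hσR.conj_diag_eq_zero hj]; rfl
  have hbound : ∀ ε : ℝ, 0 < ε → ∑ x, Q x * (σ * matLog (β x)).trace.re
      ≤ ∑ j, t j * Real.log (v * t j + c * r j + ε) := by
    intro ε hε
    have hγ : (v • pinching R σ + c • R - ∑ x, Q x • β x).PosSemidef := by
      have := (smul_pinching_sub_posSemidef hR.1 hσ).add hsum
      convert this using 1
      abel
    refine (sum_trace_mul_matLog_le hσ hQ hβ h hγ hε).trans_eq ?_
    rw [hT, hr, ← map_one (diagConj U), ← map_smul, ← map_smul, ← map_smul, ← map_add, ← map_add,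
      matLog, cfc_diagConj, trace_mul_diagConj]
    refine Finset.sum_congr rfl fun j _ => ?_
    rw [ht, mul_comm]; simp
  -- Let `ε` tend to `0`: a term with `t j = 0` vanishes identically, and otherwise `r j > 0` keeps
  -- the argument of the logarithm away from `0`.
  have hlim : ∑ x, Q x * (σ * matLog (β x)).trace.re
      ≤ ∑ j, t j * Real.log (v * t j + c * r j) := by
    have hcont : Filter.Tendsto (fun ε : ℝ => ∑ j, t j * Real.log (v * t j + c * r j + ε))
        (nhdsWithin 0 (Set.Ioi 0)) (nhds (∑ j, t j * Real.log (v * t j + c * r j + 0))) := by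
      refine tendsto_nhdsWithin_of_tendsto_nhds (tendsto_finsetSum _ fun j _ => ?_)
      rcases (ht0 j).eq_or_lt with h0 | h0
      · simp [← h0]
      · have hrj : 0 < r j := (hr0 j).lt_of_ne fun h => h0.ne' (htr j h.symm)
        have hpos : v * t j + c * r j + 0 ≠ 0 := by positivity
        have : ContinuousAt (fun ε : ℝ => t j * Real.log (v * t j + c * r j + ε)) 0 :=
          continuousAt_const.mul ((continuousAt_const.add continuousAt_id).log hpos)
        exact this.tendsto
    have := ge_of_tendsto hcont (Filter.eventually_of_mem self_mem_nhdsWithin hbound)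
    simpa using this
  have hlogR : (σ * matLog (c • R)).trace.re = ∑ j, t j * Real.log (c * r j) := by
    rw [hr, ← map_smul, matLog, cfc_diagConj, trace_mul_diagConj]
    refine Finset.sum_congr rfl fun j _ => ?_
    rw [ht, mul_comm]; simp
  have hfinal : (matPow σ (1 + s) * matPow R (-s)).trace.re
      = ∑ j, r j ^ (-s) *
        ((star (U : Matrix n n ℂ) * matPow σ (1 + s) * (U : Matrix n n ℂ)) j j).re := by
    conv_lhs => rw [hr]
    rw [matPow, matPow, cfc_diagConj, trace_mul_diagConj]
  rw [hlogR, hfinal, Finset.mul_sum]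
  refine (sub_le_sub_right hlim _).trans ?_
  rw [← Finset.sum_sub_distrib]
  refine Finset.sum_le_sum fun j _ => ?_
  have hJ := conj_diag_rpow_le hσ U j (p := 1 + s) (by linarith)
  rw [ht] at hJ
  have hvc : 0 ≤ (v / c) ^ s / s := by positivity
  -- Off the support of `R` both sides are `0`, since `0 ^ (-s) = 0` by convention.
  rcases (hr0 j).eq_or_lt with h0 | h0
  · rw [htr j h0.symm, zero_mul, zero_mul, sub_zero, ← h0, Real.zero_rpow (by linarith)]
    simp
  · refine (mul_log_sub_log_le (ht0 j) h0 hc (Nat.cast_nonneg _) hs0 hs1).trans ?_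
    rw [mul_comm (t j ^ (1 + s))]
    exact mul_le_mul_of_nonneg_left (mul_le_mul_of_nonneg_left hJ (Real.rpow_nonneg (hr0 j) _)) hvc

end

/-! ### The states as block diagonal matrices. -/

section States

variable {A B E X : Type*} [Fintype A] [DecidableEq A] [Fintype B] [DecidableEq B] [Fintype E]
  [DecidableEq E] [Fintype X] [DecidableEq X]

/-- Regrouping of the indices of a state on `B, (E, X)` with `B` and `X` classical. -/
def hashEquiv (B E X : Type*) : B × (E × X) ≃ (B × X) × E where
  toFun i := ((i.1, i.2.2), i.2.1)
  invFun i := (i.1.1, (i.2, i.1.2))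
  left_inv _ := rfl
  right_inv _ := rfl

theorem cqState_eq_blockHom (P : A → ℝ) (τ : A → Matrix E E ℂ) :
    cqState P τ = blockHom (Equiv.refl (A × E)) (fun a => P a • τ a) := by
  ext ⟨a, e⟩ ⟨a', e'⟩
  simp only [cqState, Matrix.sum_apply, Matrix.smul_apply, kroneckerMap_apply, single_apply,
    blockHom_apply, Equiv.refl_apply]
  rw [Finset.sum_eq_single a]
  · by_cases h : a = a' <;> simp [h]
  · intro b _ hb; simp [hb]
  · simp

theorem applyFun_blockHom (f : A → B) (σ : A → Matrix E E ℂ) :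
    applyFun f (blockHom (Equiv.refl (A × E)) σ)
      = blockHom (Equiv.refl (B × E)) (fun b => ∑ a with f a = b, σ a) := by
  ext ⟨b, e⟩ ⟨b', e'⟩
  simp only [applyFun, blockHom_apply, Matrix.sum_apply, of_apply, Equiv.refl_apply, if_true]
  rfl

theorem hashedState_blockHom (Q : X → ℝ) (f : X → A → B) (σ : A → Matrix E E ℂ) :
    hashedState Q f (blockHom (Equiv.refl (A × E)) σ)
      = blockHom (hashEquiv B E X) (fun k => Q k.2 • ∑ a with f k.2 a = k.1, σ a) := by
  ext ⟨b, e, x⟩ ⟨b', e', x'⟩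
  rw [hashedState, of_apply, applyFun_blockHom]
  by_cases hx : x = x'
  · subst hx
    by_cases hb : b = b'
    · subst hb
      simp only [blockHom_apply, hashEquiv, Equiv.coe_fn_mk, Equiv.refl_apply, if_true,
        Matrix.smul_apply, Complex.real_smul]
      rfl
    · simp [blockHom_apply, hashEquiv, hb]
  · simp [blockHom_apply, hashEquiv, hx]

theorem reducedE_blockHom (σ : A → Matrix E E ℂ) :
    reducedE (blockHom (Equiv.refl (A × E)) σ) = ∑ a, σ a := by
  ext e e'
  simp [reducedE, blockHom_apply, Matrix.sum_apply]

theorem one_kronecker_eq_blockHom (N : Matrix E E ℂ) :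
    (1 : Matrix A A ℂ) ⊗ₖ N = blockHom (Equiv.refl (A × E)) (fun _ => N) := by
  ext ⟨a, e⟩ ⟨a', e'⟩
  by_cases h : a = a' <;> simp [blockHom_apply, h]

theorem maxMixed_kronecker (N : Matrix E E ℂ) :
    maxMixed B ⊗ₖ N
      = blockHom (Equiv.refl (B × E)) (fun _ => ((Fintype.card B : ℝ)⁻¹) • N) := by
  rw [maxMixed, smul_kronecker, one_kronecker_eq_blockHom]
  ext i j
  by_cases h : i.1 = j.1 <;> simp [blockHom_apply, h]

theorem reducedE_hashBlock (Q : X → ℝ) (β : X → B → Matrix E E ℂ) {R : Matrix E E ℂ}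
    (hR : ∀ x, ∑ b, β x b = R) (i j : E × X) :
    reducedE (blockHom (hashEquiv B E X) (fun k => Q k.2 • β k.2 k.1)) i j
      = if i.2 = j.2 then (Q i.2 : ℂ) * R i.1 j.1 else 0 := by
  by_cases h : i.2 = j.2
  · simp [reducedE, blockHom_apply, hashEquiv, h, ← hR j.2, Matrix.sum_apply, Finset.mul_sum]
  · simp [reducedE, blockHom_apply, hashEquiv, h]

theorem reducedA_hashBlock (Q : X → ℝ) {β : X → B → Matrix E E ℂ}
    (hβ : ∀ x b, (β x b).PosSemidef) :
    reducedA (blockHom (hashEquiv B E X) (fun k => Q k.2 • β k.2 k.1))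
      = diagonal (fun b => ((∑ x, Q x * (β x b).trace.re : ℝ) : ℂ)) := by
  have htr : ∀ x b, (((β x b).trace.re : ℝ) : ℂ) = (β x b).trace := fun x b =>
    (Complex.le_def.1 (hβ x b).trace_nonneg).elim fun _ h => Complex.ext rfl (by simpa using h)
  ext b b'
  by_cases h : b = b'
  · subst h
    simp only [reducedA, of_apply, blockHom_apply, hashEquiv, Equiv.coe_fn_mk, if_true,
      Matrix.smul_apply, Complex.real_smul, diagonal_apply_eq, Complex.ofReal_sum,
      Complex.ofReal_mul, htr]
    rw [Fintype.sum_prod_type_right]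
    simp [trace, Finset.mul_sum]
  · simp [reducedA, blockHom_apply, hashEquiv, h]

theorem maxMixed_kronecker_reducedE_hashBlock (Q : X → ℝ) (β : X → B → Matrix E E ℂ)
    {R : Matrix E E ℂ} (hR : ∀ x, ∑ b, β x b = R) :
    maxMixed B ⊗ₖ reducedE (blockHom (hashEquiv B E X) (fun k => Q k.2 • β k.2 k.1))
      = blockHom (hashEquiv B E X) (fun k => ((Fintype.card B : ℝ)⁻¹ * Q k.2) • R) := by
  ext ⟨b, e, x⟩ ⟨b', e', x'⟩
  rw [kroneckerMap_apply, reducedE_hashBlock Q β hR]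
  by_cases hx : x = x' <;> by_cases hb : b = b' <;>
    simp [blockHom_apply, hashEquiv, hx, hb, maxMixed, mul_assoc]

theorem reducedA_kronecker_reducedE_hashBlock (Q : X → ℝ) {β : X → B → Matrix E E ℂ}
    (hβ : ∀ x b, (β x b).PosSemidef) {R : Matrix E E ℂ} (hR : ∀ x, ∑ b, β x b = R) :
    reducedA (blockHom (hashEquiv B E X) (fun k => Q k.2 • β k.2 k.1))
        ⊗ₖ reducedE (blockHom (hashEquiv B E X) (fun k => Q k.2 • β k.2 k.1))
      = blockHom (hashEquiv B E X)
        (fun k => ((∑ x, Q x * (β x k.1).trace.re) * Q k.2) • R) := by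
  ext ⟨b, e, x⟩ ⟨b', e', x'⟩
  rw [kroneckerMap_apply, reducedE_hashBlock Q β hR, reducedA_hashBlock Q hβ]
  by_cases hx : x = x' <;> by_cases hb : b = b' <;>
    simp [blockHom_apply, hashEquiv, hx, hb, mul_assoc]

end States

theorem ereal_coe_sum {ι : Type*} (S : Finset ι) (g : ι → ℝ) :
    ((∑ i ∈ S, g i : ℝ) : EReal) = ∑ i ∈ S, (g i : EReal) := by
  classical
  induction S using Finset.induction_on with
  | empty => simp
  | insert i S hi ih => rw [Finset.sum_insert hi, Finset.sum_insert hi, EReal.coe_add, ih]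

/-! ### Supports of scaled matrices and of summands. -/

section Support

variable {E : Type*} [Fintype E]

/-- Covers blocks of probability zero, where the second matrix degenerates to `0`. -/
theorem SuppLE.smul_of_imp {ρ σ : Matrix E E ℂ} (h : SuppLE ρ σ) {a b : ℝ}
    (hab : b = 0 → a • ρ = 0) : SuppLE (a • ρ) (b • σ) := by
  by_cases hb : b = 0
  · rw [hab hb]; intro w _; simp
  · exact h.smul a hb

theorem suppLE_sum {B : Type*} [Fintype B] [DecidableEq B] {R : Matrix E E ℂ} {β : B → Matrix E E ℂ} (hβ : ∀ b, (β b).PosSemidef)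
    (hR : ∑ b, β b = R) (b : B) : SuppLE (β b) R := by
  refine SuppLE.of_le (hβ b) ?_
  rw [← hR, ← Finset.add_sum_erase _ _ (Finset.mem_univ b), add_sub_cancel_left]
  exact posSemidef_sum _ fun c _ => hβ c

end Support

/-! ### Comparing `I`, `I'` and the average over `x`. -/

section MutualInfo

variable {B E X : Type*} [Fintype B] [DecidableEq B] [Fintype E]
  [DecidableEq E] [Fintype X] [DecidableEq X]

theorem trace_smul_mul_matLog_smul {ρ σ : Matrix E E ℂ} (hρ : ρ.PosSemidef) (hσ : σ.PosSemidef)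
    (h : SuppLE ρ σ) (a : ℝ) {c : ℝ} (hc : 0 < c) :
    ((a • ρ) * matLog (c • σ)).trace.re
      = a * ((ρ * matLog σ).trace.re + Real.log c * ρ.trace.re) := by
  rw [smul_mul_assoc, trace_smul, Complex.smul_re, smul_eq_mul, trace_mul_matLog_smul hρ hσ h hc]

theorem modMutualInfo_blockHom [Nonempty B] {β : B → Matrix E E ℂ} (hβ : ∀ b, (β b).PosSemidef)
    {R : Matrix E E ℂ} (hR : ∑ b, β b = R) :
    modMutualInfo (blockHom (Equiv.refl (B × E)) β)
      = ((∑ b, ((β b * matLog (β b)).trace.re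
          - (β b * matLog ((Fintype.card B : ℝ)⁻¹ • R)).trace.re) : ℝ) : EReal) := by
  have hRp : R.PosSemidef := hR ▸ posSemidef_sum _ fun b _ => hβ b
  have hB : (Fintype.card B : ℝ)⁻¹ ≠ 0 := by simp
  rw [modMutualInfo, reducedE_blockHom, hR, maxMixed_kronecker]
  refine relEntropy_blockHom _ (fun b => (hβ b).1) (fun b => (hRp.smul (by positivity)).1)
    fun b => ?_
  simpa using (suppLE_sum hβ hR b).smul 1 hB

theorem modMutualInfo_hashBlock [Nonempty B] {Q : X → ℝ} (hQ : ∀ x, 0 ≤ Q x)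
    {β : X → B → Matrix E E ℂ} (hβ : ∀ x b, (β x b).PosSemidef) {R : Matrix E E ℂ}
    (hRp : R.PosSemidef) (hR : ∀ x, ∑ b, β x b = R) :
    modMutualInfo (blockHom (hashEquiv B E X) (fun k => Q k.2 • β k.2 k.1))
      = ((∑ k : B × X, (((Q k.2 • β k.2 k.1) * matLog (Q k.2 • β k.2 k.1)).trace.re
          - ((Q k.2 • β k.2 k.1)
            * matLog (((Fintype.card B : ℝ)⁻¹ * Q k.2) • R)).trace.re) : ℝ) : EReal) := by
  have hB : (Fintype.card B : ℝ)⁻¹ ≠ 0 := by simp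
  rw [modMutualInfo, maxMixed_kronecker_reducedE_hashBlock Q β hR]
  refine relEntropy_blockHom _ (fun k => ((hβ _ _).smul (hQ _)).1)
    (fun k => (hRp.smul (mul_nonneg (by positivity) (hQ _))).1) fun k => ?_
  refine (suppLE_sum (hβ _) (hR _) _).smul_of_imp fun h => ?_
  rw [(mul_eq_zero.1 h).resolve_left hB, zero_smul]

/-- Both logarithms in the block `(b, x)` acquire the same summand `log (Q x)`, which cancels. -/
theorem modMutualInfo_hashBlock_eq_sum [Nonempty B] {Q : X → ℝ} (hQ : ∀ x, 0 ≤ Q x)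
    {β : X → B → Matrix E E ℂ} (hβ : ∀ x b, (β x b).PosSemidef) {R : Matrix E E ℂ}
    (hRp : R.PosSemidef) (hR : ∀ x, ∑ b, β x b = R) :
    modMutualInfo (blockHom (hashEquiv B E X) (fun k => Q k.2 • β k.2 k.1))
      = ∑ x, (Q x : EReal) * modMutualInfo (blockHom (Equiv.refl (B × E)) (β x)) := by
  have hB : 0 < (Fintype.card B : ℝ)⁻¹ := by positivity
  rw [modMutualInfo_hashBlock hQ hβ hRp hR]
  simp_rw [fun x => modMutualInfo_blockHom (hβ x) (hR x), ← EReal.coe_mul, ← ereal_coe_sum]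
  congr 1
  rw [Fintype.sum_prod_type_right]
  refine Finset.sum_congr rfl fun x _ => ?_
  rw [Finset.mul_sum]
  refine Finset.sum_congr rfl fun b _ => ?_
  rcases (hQ x).eq_or_lt with h | h
  · simp [← h]
  · have hs := suppLE_sum (hβ x) (hR x) b
    rw [trace_smul_mul_matLog_smul (hβ x b) (hβ x b) (fun _ h => h) _ h, mul_comm _ (Q x),
      ← smul_smul, trace_smul_mul_matLog_smul (hβ x b) (hRp.smul hB.le)
        (by simpa using hs.smul 1 hB.ne') _ h]
    ring

theorem sub_le_mul_log {p m : ℝ} (hp : 0 ≤ p) (hm : 0 < m) :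
    p - m ≤ p * (Real.log p - Real.log m) := by
  rcases hp.eq_or_lt with rfl | hp
  · simp [hm.le]
  · have h := Real.log_le_sub_one_of_pos (div_pos hm hp)
    rw [Real.log_div hm.ne' hp.ne'] at h
    have h2 : p * (m / p) = m := by field_simp
    nlinarith [mul_le_mul_of_nonneg_left h hp.le]

/-- The two quantities differ by `∑ p b (log (p b) - log m)`, where `p` is the distribution of the
hash value and `m` its uniform weight; Gibbs' inequality concludes. -/
theorem mutualInfo_hashBlock_le [Nonempty B] {Q : X → ℝ} (hQ : Q ∈ stdSimplex ℝ X)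
    {β : X → B → Matrix E E ℂ} (hβ : ∀ x b, (β x b).PosSemidef) {R : Matrix E E ℂ}
    (hRp : R.PosSemidef) (hRt : R.trace = 1) (hR : ∀ x, ∑ b, β x b = R) :
    mutualInfo (blockHom (hashEquiv B E X) (fun k => Q k.2 • β k.2 k.1))
      ≤ modMutualInfo (blockHom (hashEquiv B E X) (fun k => Q k.2 • β k.2 k.1)) := by
  have hm : 0 < (Fintype.card B : ℝ)⁻¹ := by positivity
  set m := (Fintype.card B : ℝ)⁻¹ with hmdef
  set p : B → ℝ := fun b => ∑ x, Q x * (β x b).trace.re with hpdef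
  have htr : ∀ x b, 0 ≤ (β x b).trace.re := fun x b =>
    (Complex.le_def.1 (hβ x b).trace_nonneg).1
  have hterm : ∀ x b, 0 ≤ Q x * (β x b).trace.re := fun x b => mul_nonneg (hQ.1 x) (htr x b)
  have hp : ∀ b, 0 ≤ p b := fun b => Finset.sum_nonneg fun x _ => hterm x b
  have hzero : ∀ x b, p b * Q x = 0 → Q x • β x b = 0 := by
    intro x b h
    rcases mul_eq_zero.1 h with h | h
    · have h1 := (Finset.sum_eq_zero_iff_of_nonneg fun x _ => hterm x b).1 h x (Finset.mem_univ x)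
      rcases mul_eq_zero.1 h1 with h2 | h2
      · rw [h2, zero_smul]
      · rw [(hβ x b).trace_eq_zero_iff.1, smul_zero]
        exact Complex.ext h2 (Complex.le_def.1 (hβ x b).trace_nonneg).2.symm
    · rw [h, zero_smul]
  have hsum : ∑ b, p b = 1 := by
    simp only [hpdef]
    rw [Finset.sum_comm]
    calc _ = ∑ x, Q x := Finset.sum_congr rfl fun x _ => by
          rw [← Finset.mul_sum, ← Complex.re_sum, ← trace_sum, hR, hRt]; simp
      _ = 1 := hQ.2
  rw [modMutualInfo_hashBlock hQ.1 hβ hRp hR, mutualInfo,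
    reducedA_kronecker_reducedE_hashBlock Q hβ hR, relEntropy_blockHom _
      (fun k => ((hβ _ _).smul (hQ.1 _)).1)
      (fun k => (hRp.smul (mul_nonneg (hp _) (hQ.1 _))).1)
      (fun k => (suppLE_sum (hβ _) (hR _) _).smul_of_imp (hzero _ _)), EReal.coe_le_coe_iff,
    Finset.sum_sub_distrib, Finset.sum_sub_distrib]
  refine sub_le_sub_left ?_ _
  have hstep : ∀ k : B × X, ((Q k.2 • β k.2 k.1) * matLog ((m * Q k.2) • R)).trace.re
      + Q k.2 * (β k.2 k.1).trace.re * (Real.log (p k.1) - Real.log m)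
      = ((Q k.2 • β k.2 k.1) * matLog ((p k.1 * Q k.2) • R)).trace.re := by
    rintro ⟨b, x⟩
    dsimp only
    by_cases h : p b * Q x = 0
    · have h0 := hzero x b h
      have h1 : Q x * (β x b).trace.re = 0 := by
        simpa using congrArg (fun N : Matrix E E ℂ => N.trace.re) h0
      rw [h0, h1]; simp
    · have hQx : 0 < Q x := (hQ.1 x).lt_of_ne fun h0 => h (by rw [← h0, mul_zero])
      have hpb : 0 < p b := (hp b).lt_of_ne fun h0 => h (by rw [← h0, zero_mul])
      have hs := suppLE_sum (hβ x) (hR x) b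
      rw [trace_smul_mul_matLog_smul (hβ x b) hRp hs _ (mul_pos hm hQx),
        trace_smul_mul_matLog_smul (hβ x b) hRp hs _ (mul_pos hpb hQx),
        Real.log_mul hm.ne' hQx.ne', Real.log_mul hpb.ne' hQx.ne']
      ring
  have hgibbs : 0 ≤ ∑ k : B × X,
      Q k.2 * (β k.2 k.1).trace.re * (Real.log (p k.1) - Real.log m) := by
    rw [Fintype.sum_prod_type]
    simp_rw [← Finset.sum_mul]
    have h1 : ∑ b, (p b - m) = 0 := by
      rw [Finset.sum_sub_distrib, hsum]; simp [hmdef]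
    rw [← h1]
    exact Finset.sum_le_sum fun b _ => sub_le_mul_log (hp b) hm
  rw [← Finset.sum_congr rfl fun k _ => hstep k, Finset.sum_add_distrib]
  linarith

end MutualInfo

/-! ### Universal hashing and the final bound. -/

/-- Each `σ a'` occurs with a nonnegative coefficient: `1 + 1/M - 1` for `a' = a`, and `1/M` minus
the collision probability otherwise. -/
theorem collision_posSemidef {A E X : Type*} [Fintype A] [DecidableEq A] [Fintype X] {M : ℕ} {Q : X → ℝ} (hQ : Q ∈ stdSimplex ℝ X) {f : X → A → Fin M}
    (hf : IsUniversalTwo Q f) {σ : A → Matrix E E ℂ} (hσ : ∀ a, (σ a).PosSemidef) (a : A) :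
    (σ a + (M : ℝ)⁻¹ • ∑ a', σ a' - ∑ x, Q x • ∑ a' with f x a' = f x a, σ a').PosSemidef := by
  have h : σ a + (M : ℝ)⁻¹ • ∑ a', σ a' - ∑ x, Q x • ∑ a' with f x a' = f x a, σ a'
      = ∑ a', ((if a' = a then 1 else 0) + (M : ℝ)⁻¹ - ∑ x with f x a' = f x a, Q x) • σ a' := by
    simp only [sub_smul, add_smul, Finset.sum_sub_distrib, Finset.sum_add_distrib, ite_smul,
      one_smul, zero_smul, Finset.sum_ite_eq', Finset.mem_univ, if_true, Finset.smul_sum,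
      Finset.sum_smul]
    congr 1
    simp only [Finset.sum_filter]
    exact Finset.sum_comm
  rw [h]
  refine posSemidef_sum _ fun a' _ => (hσ a').smul ?_
  by_cases ha : a' = a
  · subst ha
    have : 0 ≤ (M : ℝ)⁻¹ := by positivity
    simp [hQ.2, this]
  · have := hf a' a ha
    rw [one_div] at this
    simpa [ha] using this

section LeftoverHashing

variable {A E X : Type*} [Fintype A] [DecidableEq A] [Fintype E] [DecidableEq E]
    [Fintype X]

theorem sum_modMutualInfo_le {M : ℕ} (hM : 0 < M) {Q : X → ℝ} (hQ : Q ∈ stdSimplex ℝ X)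
    {f : X → A → Fin M} (hf : IsUniversalTwo Q f) {σ : A → Matrix E E ℂ}
    (hσ : ∀ a, (σ a).PosSemidef) {s : ℝ} (hs0 : 0 < s) (hs1 : s ≤ 1) :
    ∑ x, (Q x : EReal) * modMutualInfo
        (blockHom (Equiv.refl (Fin M × E)) (fun b => ∑ a with f x a = b, σ a))
      ≤ (((numEigenvalues (∑ a, σ a) : ℝ) ^ s * (M : ℝ) ^ s / s *
          ∑ a, (matPow (σ a) (1 + s) * matPow (∑ a, σ a) (-s)).trace.re : ℝ) : EReal) := by
  have : Nonempty (Fin M) := ⟨⟨0, hM⟩⟩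
  have hM' : (0 : ℝ) < (M : ℝ)⁻¹ := by positivity
  set R := ∑ a, σ a with hR
  have hRp : R.PosSemidef := posSemidef_sum _ fun a _ => hσ a
  have hβ : ∀ x b, (∑ a with f x a = b, σ a).PosSemidef := fun x b =>
    posSemidef_sum _ fun a _ => hσ a
  have hβR : ∀ x, ∑ b, ∑ a with f x a = b, σ a = R := fun x =>
    Finset.sum_fiberwise _ _ _
  have hsupp : ∀ a x, SuppLE (σ a) (∑ a' with f x a' = f x a, σ a') := by
    intro a x
    refine SuppLE.of_le (hσ a) ?_
    rw [← Finset.add_sum_erase _ _ (show a ∈ Finset.univ.filter fun a' => f x a' = f x a by simp),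
      add_sub_cancel_left]
    exact posSemidef_sum _ fun c _ => hσ c
  -- Each block is the sum over its fibre, so the sum over hash values becomes a sum over `a`.
  have hx : ∀ x, ∑ b, (((∑ a with f x a = b, σ a) * matLog (∑ a with f x a = b, σ a)).trace.re
      - ((∑ a with f x a = b, σ a) * matLog ((M : ℝ)⁻¹ • R)).trace.re)
      = ∑ a, ((σ a * matLog (∑ a' with f x a' = f x a, σ a')).trace.re
        - (σ a * matLog ((M : ℝ)⁻¹ • R)).trace.re) := by
    intro x
    rw [← Finset.sum_fiberwise _ (f x)]
    refine Finset.sum_congr rfl fun b _ => ?_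
    rw [Finset.sum_mul, Finset.sum_mul, trace_sum, trace_sum, Complex.re_sum, Complex.re_sum,
      ← Finset.sum_sub_distrib]
    refine Finset.sum_congr rfl fun a ha => ?_
    rw [(Finset.mem_filter.1 ha).2]
  simp_rw [fun x => modMutualInfo_blockHom (hβ x) (hβR x), Fintype.card_fin, hx, ← EReal.coe_mul,
    ← ereal_coe_sum]
  rw [EReal.coe_le_coe_iff]
  simp_rw [Finset.mul_sum]
  rw [Finset.sum_comm]
  refine Finset.sum_le_sum fun a _ => ?_
  have hmain := sum_trace_mul_matLog_sub_le (hσ a) hRp (suppLE_sum hσ rfl a) hQ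
    (fun x => hβ x (f x a)) (hsupp a) hM' (collision_posSemidef hQ hf hσ a) hs0 hs1
  rw [div_inv_eq_mul, Real.mul_rpow (by positivity) (by positivity)] at hmain
  refine le_of_eq_of_le ?_ hmain
  simp_rw [mul_sub]
  rw [Finset.sum_sub_distrib, ← Finset.sum_mul, hQ.2, one_mul]

/-- Stated as an inequality because `x ≤ exp (log x)` holds for every real `x`, so positivity of the
trace is not needed. -/
theorem sum_trace_le_exp_condRenyi {σ : A → Matrix E E ℂ} (hσ : ∀ a, (σ a).PosSemidef) {s : ℝ}
    (hs0 : s ≠ 0) :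
    ∑ a, (matPow (σ a) (1 + s) * matPow (∑ a, σ a) (-s)).trace.re
      ≤ Real.exp (-s * condRenyi s (blockHom (Equiv.refl (A × E)) σ)) := by
  have h : -s * condRenyi s (blockHom (Equiv.refl (A × E)) σ)
      = Real.log (∑ a, (matPow (σ a) (1 + s) * matPow (∑ a, σ a) (-s)).trace.re) := by
    rw [condRenyi, reducedE_blockHom, one_kronecker_eq_blockHom, matPow,
      cfc_blockHom _ (fun a => (hσ a).1), ← map_mul, trace_blockHom, Complex.re_sum,
      ← mul_assoc]
    have : -s * (-1 / s) = 1 := by field_simp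
    rw [this, one_mul]; rfl
  rw [h]
  exact Real.le_exp_log _

theorem universalTwo_modMutualInfo_le [Nonempty A] [DecidableEq X] {M : ℕ} {Q : X → ℝ}
    (hQ : Q ∈ stdSimplex ℝ X) {f : X → A → Fin M} (hf : IsUniversalTwo Q f)
    {σ : A → Matrix E E ℂ} (hσ : ∀ a, (σ a).PosSemidef) (hσt : (∑ a, σ a).trace = 1)
    {ρ : Matrix (A × E) (A × E) ℂ} (hρ : ρ = blockHom (Equiv.refl (A × E)) σ)
    {v : ℕ} (hv : v = numEigenvalues (reducedE ρ)) {s : ℝ} (hs0 : 0 < s) (hs1 : s ≤ 1) :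
    mutualInfo (hashedState Q f ρ) ≤ modMutualInfo (hashedState Q f ρ) ∧
    modMutualInfo (hashedState Q f ρ)
      = ∑ x, ((Q x : ℝ) : EReal) * modMutualInfo (applyFun (f x) ρ) ∧
    ∑ x, ((Q x : ℝ) : EReal) * modMutualInfo (applyFun (f x) ρ)
      ≤ (((v : ℝ) ^ s * (M : ℝ) ^ s / s * Real.exp (-s * condRenyi s ρ) : ℝ) : EReal) ∧
    (v : ℝ) ^ s * (M : ℝ) ^ s / s * Real.exp (-s * condRenyi s ρ)
      = (v : ℝ) ^ s * (Real.exp (s * (Real.log M - condRenyi s ρ)) / s) := by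
  have hX : Nonempty X := by
    by_contra h
    rw [not_nonempty_iff] at h
    simpa using hQ.2
  -- A value of a hash function inhabits `Fin M`.
  have hM : 0 < M := Fin.pos (f hX.some (Classical.arbitrary A))
  have : Nonempty (Fin M) := ⟨⟨0, hM⟩⟩
  have hRp : (∑ a, σ a).PosSemidef := posSemidef_sum _ fun a _ => hσ a
  have hβ : ∀ x b, (∑ a with f x a = b, σ a).PosSemidef := fun x b =>
    posSemidef_sum _ fun a _ => hσ a
  have hβR : ∀ x, ∑ b, ∑ a with f x a = b, σ a = ∑ a, σ a := fun x =>
    Finset.sum_fiberwise _ _ _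
  rw [hρ, reducedE_blockHom] at hv
  have happ : ∀ x, applyFun (f x) ρ
      = blockHom (Equiv.refl (Fin M × E)) (fun b => ∑ a with f x a = b, σ a) := fun x => by
    rw [hρ, applyFun_blockHom]
  have hhash : hashedState Q f ρ = blockHom (hashEquiv (Fin M) E X)
      (fun k => Q k.2 • ∑ a with f k.2 a = k.1, σ a) := by
    rw [hρ, hashedState_blockHom]
  refine ⟨?_, ?_, ?_, ?_⟩
  · rw [hhash]
    exact mutualInfo_hashBlock_le (β := fun x b => ∑ a with f x a = b, σ a) hQ hβ hRp hσt hβR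
  · rw [hhash]
    simp only [happ]
    exact modMutualInfo_hashBlock_eq_sum (β := fun x b => ∑ a with f x a = b, σ a) hQ.1 hβ hRp hβR
  · simp only [happ]
    refine (sum_modMutualInfo_le hM hQ hf hσ hs0 hs1).trans ?_
    rw [EReal.coe_le_coe_iff, hv, hρ]
    exact mul_le_mul_of_nonneg_left (sum_trace_le_exp_condRenyi hσ hs0.ne') (by positivity)
  · rw [mul_sub, sub_eq_add_neg, Real.exp_add, mul_comm s (Real.log M),
      ← Real.rpow_def_of_pos (by exact_mod_cast hM), neg_mul]
    ring

end LeftoverHashing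

end PrivacyAmp

open PrivacyAmp

theorem theorem1 {A E X : Type*} [Fintype A] [DecidableEq A] [Fintype E] [DecidableEq E]
    [Fintype X] [DecidableEq X]
    (P : A → ℝ) (hP : P ∈ stdSimplex ℝ A)
    (τ : A → Matrix E E ℂ) (hτ : ∀ a, IsDensity (τ a))
    (ρ : Matrix (A × E) (A × E) ℂ) (hρ : ρ = cqState P τ)
    (M : ℕ) (Q : X → ℝ) (hQ : Q ∈ stdSimplex ℝ X)
    (f : X → A → Fin M) (hf : IsUniversalTwo Q f)
    (v : ℕ) (hv : v = numEigenvalues (reducedE ρ))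
    (s : ℝ) (hs0 : 0 < s) (hs1 : s ≤ 1) :
    mutualInfo (hashedState Q f ρ) ≤ modMutualInfo (hashedState Q f ρ) ∧
    modMutualInfo (hashedState Q f ρ)
      = ∑ x, ((Q x : ℝ) : EReal) * modMutualInfo (applyFun (f x) ρ) ∧
    ∑ x, ((Q x : ℝ) : EReal) * modMutualInfo (applyFun (f x) ρ)
      ≤ (((v : ℝ) ^ s * (M : ℝ) ^ s / s * Real.exp (-s * condRenyi s ρ) : ℝ) : EReal) ∧
    (v : ℝ) ^ s * (M : ℝ) ^ s / s * Real.exp (-s * condRenyi s ρ)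
      = (v : ℝ) ^ s * (Real.exp (s * (Real.log M - condRenyi s ρ)) / s) := by
  have hA : Nonempty A := by
    by_contra h
    rw [not_nonempty_iff] at h
    simpa using hP.2
  refine universalTwo_modMutualInfo_le hQ hf (fun a => (hτ a).1.smul (hP.1 a)) ?_
    (hρ.trans (cqState_eq_blockHom P τ)) hv hs0 hs1
  simp_rw [Matrix.trace_sum, Matrix.trace_smul, (hτ _).2]
  rw [← Finset.sum_smul, hP.2, one_smul]
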